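/- Assume Martin's axiom: for every nonempty partially ordered set $P$ with the countable chain condition and every family of fewer than $2^{\aleph_0}$ dense subsets of $P$ there is a filter in $P$ that meets every member of the family. Let $G$ be a locally compact group with a (regular) left Haar measure $\mu$, let $H$ be an arbitrary topological group, and let $f:G\to H$ be a group homomorphism that is Haar measurable, that is, for every open set $U\subset H$ the set $f^{-1}(U)$ is measurable in the sense of Carathéodory with respect to the outer measure $\mu^*$. Then $f$ is continuous. -/

import Mathlib

/-- Two conditions of a forcing order are compatible if they have a common extension
(stronger conditions are smaller). -/
def ForcingCompatible {P : Type*} [PartialOrder P] (p q : P) : Prop :=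
  ∃ r : P, r ≤ p ∧ r ≤ q

/-- The countable chain condition: every family of pairwise incompatible conditions is countable. -/
def CountableChainCondition (P : Type*) [PartialOrder P] : Prop :=
  ∀ A : Set P, A.Pairwise (fun p q => ¬ ForcingCompatible p q) → A.Countable

/-- A set of conditions is dense if every condition has an extension in it. -/
def ForcingDense {P : Type*} [PartialOrder P] (D : Set P) : Prop :=
  ∀ p : P, ∃ d ∈ D, d ≤ p

/-- Martin's axiom: for every nonempty partial order with the countable chain condition and every
family of fewer than continuum many dense sets there is a filter (a nonempty, downward directed
upper set) that meets all of them. -/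
def MartinsAxiom : Prop :=
  ∀ (P : Type) [PartialOrder P] [Nonempty P], CountableChainCondition P →
    ∀ 𝒟 : Set (Set P), Cardinal.mk 𝒟 < Cardinal.continuum → (∀ D ∈ 𝒟, ForcingDense D) →
      ∃ F : Order.PFilter P, ∀ D ∈ 𝒟, ((F : Set P) ∩ D).Nonempty

/-- For a regular left Haar measure `μ`, the Haar measurable sets are the sets that are
Carathéodory measurable for the outer measure of `μ`. Locally null sets are Haar measurable. -/
def IsHaarMeasurableSet {G : Type*} [MeasurableSpace G] (μ : MeasureTheory.Measure G)
    (A : Set G) : Prop :=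
  μ.toOuterMeasure.IsCaratheodory A

/-- A map to a topological space is Haar measurable if preimages of open sets are. -/
def IsHaarMeasurableMap {G Y : Type*} [MeasurableSpace G] [TopologicalSpace Y]
    (μ : MeasureTheory.Measure G) (f : G → Y) : Prop :=
  ∀ U : Set Y, IsOpen U → IsHaarMeasurableSet μ (f ⁻¹' U)

open Set Filter Topology MeasureTheory
open scoped Pointwise ENNReal

/-! An open σ-compact subgroup reduces everything to σ-compact `G`. Given a neighborhood `U` of `1`
in `H`, take an open `V` with `V / V ⊆ U`. If `f ⁻¹' V` is not null, Steinhaus' theorem gives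
continuity at `1`. If `N = f ⁻¹' V` were null, every `B * N` would still be measurable, being the
preimage of the open set `f '' B * V`; `MartinsAxiom.exists_mul_not_isHaarMeasurableSet` refutes
this.

For that, `exists_null_saturation` moves `N` to a null set in a second countable quotient. There are
at most continuum many compact sets of positive measure there, and by random forcing fewer than
continuum many null sets cover none of them, so a Bernstein recursion builds the nonmeasurable union
of translates. -/

/-! ### Second countable quotients and completion regularity -/

theorem exists_small_conj_nhds_one {G : Type*} [Group G] [TopologicalSpace G]
    [IsTopologicalGroup G] {F W V : Set G} (hF : IsCompact F) (hW : W ∈ 𝓝 (1 : G))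
    (hV : V ∈ 𝓝 (1 : G)) :
    ∃ W' ∈ 𝓝 (1 : G), IsClosed W' ∧ W' ⊆ W ∩ V ∧ (∀ x ∈ W', x⁻¹ ∈ W) ∧
      (∀ x ∈ W', ∀ y ∈ W', x * y ∈ W) ∧ ∀ g ∈ F, ∀ x ∈ W', g * x * g⁻¹ ∈ W := by
  obtain ⟨A, hAo, h1A, hA⟩ := exists_open_nhds_one_mul_subset hW
  have hconj : ∀ᶠ x in 𝓝 (1 : G), ∀ g ∈ F, g * x * g⁻¹ ∈ W := by
    refine hF.eventually_forall_of_forall_eventually (P := fun x g => g * x * g⁻¹ ∈ W) ?_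
    intro g _
    have : Continuous fun z : G × G => z.2 * z.1 * z.2⁻¹ := by fun_prop
    exact this.continuousAt.preimage_mem_nhds (by simpa using hW)
  have hinv : ∀ᶠ x in 𝓝 (1 : G), x⁻¹ ∈ W :=
    continuous_inv.continuousAt.preimage_mem_nhds (by simpa using hW)
  have hall : {x : G | (x ∈ W ∧ x ∈ V) ∧ x ∈ A ∧ x⁻¹ ∈ W ∧ ∀ g ∈ F, g * x * g⁻¹ ∈ W} ∈ 𝓝 (1 : G) := by
    filter_upwards [hW, hV, hAo.mem_nhds h1A, hinv, hconj] with x h1 h2 h3 h4 h5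
    exact ⟨⟨h1, h2⟩, h3, h4, h5⟩
  obtain ⟨W', hW', hc, hs⟩ := exists_mem_nhds_isClosed_subset hall
  refine ⟨W', hW', hc, fun x hx => (hs hx).1, fun x hx => (hs hx).2.2.1, fun x hx y hy => ?_,
    fun g hg x hx => (hs hx).2.2.2 g hg⟩
  exact hA (mul_mem_mul (hs hx).2.1 (hs hy).2.1)

/-- A sequence of neighborhoods of `1` in a σ-compact locally compact group contains a compact
normal subgroup with second countable quotient (Kakutani–Kodaira). -/
theorem exists_compact_normal_subgroup_secondCountable {G : Type*} [Group G] [TopologicalSpace G]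
    [IsTopologicalGroup G] [LocallyCompactSpace G] [SigmaCompactSpace G] (V : ℕ → Set G)
    (hV : ∀ n, V n ∈ 𝓝 (1 : G)) :
    ∃ K : Subgroup G, K.Normal ∧ IsCompact (K : Set G) ∧ IsClosed (K : Set G) ∧
      (∀ n, (K : Set G) ⊆ V n) ∧ SecondCountableTopology (G ⧸ K) := by
  obtain ⟨W₀, hW₀, hW₀c, hW₀comp⟩ : ∃ W₀ ∈ 𝓝 (1 : G), IsClosed W₀ ∧ IsCompact W₀ := by
    obtain ⟨C, hC, hC1⟩ := exists_compact_mem_nhds (1 : G)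
    exact ⟨closure C, mem_of_superset hC1 subset_closure, isClosed_closure, hC.closure⟩
  choose step hstep using fun (n : ℕ) (W : {W : Set G // W ∈ 𝓝 (1 : G)}) =>
    exists_small_conj_nhds_one (isCompact_compactCovering G n) W.2 (hV n)
  let S : ℕ → {W : Set G // W ∈ 𝓝 (1 : G)} := fun n =>
    Nat.rec ⟨W₀, hW₀⟩ (fun n W => ⟨step n W, (hstep n W).1⟩) n
  let W : ℕ → Set G := fun n => (S n).1
  have hWn : ∀ n, W n ∈ 𝓝 (1 : G) := fun n => (S n).2
  have hs : ∀ n, IsClosed (W (n + 1)) ∧ W (n + 1) ⊆ W n ∩ V n ∧ (∀ x ∈ W (n + 1), x⁻¹ ∈ W n) ∧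
      (∀ x ∈ W (n + 1), ∀ y ∈ W (n + 1), x * y ∈ W n) ∧
      ∀ g ∈ compactCovering G n, ∀ x ∈ W (n + 1), g * x * g⁻¹ ∈ W n :=
    fun n => (hstep n (S n)).2
  have hclosed : ∀ n, IsClosed (W n) := by
    rintro (_ | n)
    · exact hW₀c
    · exact (hs n).1
  have hanti : Antitone W := antitone_nat_of_succ_le fun n => ((hs n).2.1).trans inter_subset_left
  have hcomp : ∀ n, IsCompact (W n) := fun n =>
    hW₀comp.of_isClosed_subset (hclosed n) (hanti (Nat.zero_le n))
  let K : Subgroup G :=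
    { carrier := ⋂ n, W n
      one_mem' := mem_iInter.2 fun n => mem_of_mem_nhds (hWn n)
      mul_mem' := fun {x y} hx hy => mem_iInter.2 fun n =>
        (hs n).2.2.2.1 x (mem_iInter.1 hx (n + 1)) y (mem_iInter.1 hy (n + 1))
      inv_mem' := fun {x} hx => mem_iInter.2 fun n => (hs n).2.2.1 x (mem_iInter.1 hx (n + 1)) }
  have hKdef : (K : Set G) = ⋂ n, W n := rfl
  have hKclosed : IsClosed (K : Set G) := isClosed_iInter hclosed
  have hKcomp : IsCompact (K : Set G) :=
    (hcomp 0).of_isClosed_subset hKclosed (iInter_subset _ 0)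
  have hKn : K.Normal := by
    refine ⟨fun x hx g => mem_iInter.2 fun n => ?_⟩
    obtain ⟨m, hm⟩ := exists_mem_compactCovering g
    -- Step `n` only controls conjugation by the `n`-th compact piece, so go far enough for that
    -- piece to contain `g`.
    refine hanti (le_max_left n m) ((hs (max n m)).2.2.2.2 g ?_ x (mem_iInter.1 hx (max n m + 1)))
    exact compactCovering_subset G (le_max_right n m) hm
  refine ⟨K, hKn, hKcomp, hKclosed, fun n => (iInter_subset _ (n + 1)).trans
    ((hs n).2.1.trans inter_subset_right), ?_⟩
  have hbasis : (𝓝 (1 : G ⧸ K)).HasBasis (fun _ : ℕ => True)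
      fun n => ((↑) : G → G ⧸ K) '' W n := by
    refine ⟨fun t => ⟨fun ht => ?_, ?_⟩⟩
    · obtain ⟨O, hOt, hO, h1O⟩ := mem_nhds_iff.1 ht
      have hpre : IsOpen (((↑) : G → G ⧸ K) ⁻¹' O) := hO.preimage QuotientGroup.continuous_mk
      have hsub : (⋂ n, W n) ⊆ ((↑) : G → G ⧸ K) ⁻¹' O := by
        intro x hx
        have : (x : G ⧸ K) = 1 := (QuotientGroup.eq_one_iff x).2 hx
        simpa [this] using h1O
      obtain ⟨n, hn⟩ := exists_subset_nhds_of_isCompact' (hanti.directed_ge) hcomp hclosed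
        (fun x hx => hpre.mem_nhds (hsub hx))
      exact ⟨n, trivial, (image_subset_iff.2 hn).trans hOt⟩
    · rintro ⟨n, -, hn⟩
      refine mem_of_superset ?_ hn
      have := QuotientGroup.isOpenMap_coe (N := K) |>.image_mem_nhds (hWn n)
      simpa using this
  have hcg : (𝓝 (1 : G ⧸ K)).IsCountablyGenerated :=
    HasCountableBasis.isCountablyGenerated ⟨hbasis, to_countable _⟩
  -- A countable base at `1` makes the quotient pseudometrizable; with σ-compactness this yields
  -- second countability.
  let : UniformSpace (G ⧸ K) := IsTopologicalGroup.rightUniformSpace (G ⧸ K)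
  have hug : (uniformity (G ⧸ K)).IsCountablyGenerated := by
    rw [uniformity_eq_comap_nhds_one']
    exact Filter.comap.isCountablyGenerated _ _
  have : SigmaCompactSpace (G ⧸ K) := by
    refine isSigmaCompact_univ_iff.1 ?_
    have := isSigmaCompact_univ.image (f := ((↑) : G → G ⧸ K)) QuotientGroup.continuous_mk
    rwa [image_univ, QuotientGroup.mk_surjective.range_eq] at this
  let := UniformSpace.pseudoMetricSpace (G ⧸ K)
  infer_instance

/-- For `k ∈ K` the translate `k • O` exceeds `O` only by a null set, as each `k • C n` stays in
`O`. The saturation is a possibly uncountable union of such translates, but finitely many cover a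
given compact subset, and inner regularity concludes. -/
theorem measure_saturation_sdiff_eq_zero {G : Type*} [Group G] [TopologicalSpace G]
    [IsTopologicalGroup G] [LocallyCompactSpace G] [SigmaCompactSpace G] [MeasurableSpace G]
    [BorelSpace G] (μ : Measure G) [μ.IsHaarMeasure] [μ.Regular] (K : Subgroup G) [K.Normal]
    {O : Set G} (hO : IsOpen O) {C : ℕ → Set G} (hC : μ (O \ ⋃ n, C n) = 0)
    (hKC : ∀ n, (K : Set G) * C n ⊆ O) :
    μ (((↑) : G → G ⧸ K) ⁻¹' (((↑) : G → G ⧸ K) '' O) \ O) = 0 := by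
  by_contra hpos
  have hopen : IsOpen (((↑) : G → G ⧸ K) ⁻¹' (((↑) : G → G ⧸ K) '' O)) :=
    (QuotientGroup.isOpenMap_coe _ hO).preimage QuotientGroup.continuous_mk
  obtain ⟨D, hDsub, hD, hDpos⟩ := (hopen.measurableSet.diff hO.measurableSet).exists_lt_isCompact
    (pos_iff_ne_zero.2 hpos)
  have hnull : μ (D \ O) = 0 := by
    refine hD.induction_on (p := fun s => μ (s \ O) = 0) (by simp)
      (fun s t hst ht => measure_mono_null (sdiff_subset_sdiff_left hst) ht)
      (fun s t hs ht => by rw [union_sdiff_distrib]; exact measure_union_null hs ht) ?_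
    intro c hc
    obtain ⟨x, hx, hxc⟩ := (hDsub hc).1
    have hk : c * x⁻¹ ∈ K := by
      have h : x⁻¹ * c ∈ K := QuotientGroup.eq.1 hxc
      exact (Subgroup.Normal.mem_comm_iff inferInstance).1 h
    refine ⟨(c * x⁻¹) • O, mem_nhdsWithin_of_mem_nhds ((hO.smul (c * x⁻¹)).mem_nhds
      ⟨x, hx, by simp⟩), ?_⟩
    refine measure_mono_null (t := (c * x⁻¹) • (O \ ⋃ n, C n)) ?_ (by rw [measure_smul, hC])
    rintro _ ⟨⟨y, hy, rfl⟩, hyO⟩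
    refine ⟨y, ⟨hy, fun hyC => hyO ?_⟩, rfl⟩
    obtain ⟨n, hn⟩ := mem_iUnion.1 hyC
    exact hKC n (mul_mem_mul hk hn)
  exact hDpos.ne' (measure_mono_null (show D ⊆ D \ O from fun x hx => ⟨hx, (hDsub hx).2⟩) hnull)

/-- A null set of a σ-compact locally compact group is contained in a null `G_δ` set that is
saturated for a compact normal subgroup with second countable quotient: Haar measure is completion
regular. -/
theorem exists_null_saturation {G : Type*} [Group G] [TopologicalSpace G]
    [IsTopologicalGroup G] [LocallyCompactSpace G] [SigmaCompactSpace G] [MeasurableSpace G]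
    [BorelSpace G] (μ : Measure G) [μ.IsHaarMeasure] [μ.Regular] {N : Set G} (hN : μ N = 0) :
    ∃ K : Subgroup G, K.Normal ∧ IsCompact (K : Set G) ∧ IsClosed (K : Set G) ∧
      SecondCountableTopology (G ⧸ K) ∧ ∃ T : Set (G ⧸ K), IsGδ T ∧
        (((↑) : G → G ⧸ K) '' N) ⊆ T ∧ μ (((↑) : G → G ⧸ K) ⁻¹' T) = 0 := by
  have hε : ∀ n : ℕ, (0 : ℝ≥0∞) < ((n : ℝ≥0∞) + 1)⁻¹ := fun n => by
    rw [ENNReal.inv_pos]; exact_mod_cast ENNReal.natCast_ne_top (n + 1)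
  have hO : ∀ n : ℕ, ∃ O : Set G, N ⊆ O ∧ IsOpen O ∧ μ O < ((n : ℝ≥0∞) + 1)⁻¹ := fun n =>
    N.exists_isOpen_lt_of_lt _ (by rw [hN]; exact hε n)
  choose O hNO hOo hOμ using hO
  have hC : ∀ n m : ℕ, ∃ C ⊆ O n, IsCompact C ∧ IsClosed C ∧
      μ (O n \ C) < ((m : ℝ≥0∞) + 1)⁻¹ := fun n m =>
    (hOo n).measurableSet.exists_isCompact_isClosed_sdiff_lt ((hOμ n).ne_top) (hε m).ne'
  choose C hCO hCc _ hCμ using hC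
  choose V hV hVC using fun n m => compact_open_separated_mul_left (hCc n m) (hOo n) (hCO n m)
  obtain ⟨K, hKn, hKc, hKcl, hKV, hK2⟩ := exists_compact_normal_subgroup_secondCountable
    (fun i : ℕ => V i.unpair.1 i.unpair.2) (fun i => hV _ _)
  have hlim : Tendsto (fun n : ℕ => ((n : ℝ≥0∞) + 1)⁻¹) atTop (𝓝 0) := by
    have := (tendsto_add_atTop_iff_nat 1).2 ENNReal.tendsto_inv_nat_nhds_zero
    simpa using this
  have hdiff : ∀ n, μ (O n \ ⋃ m, C n m) = 0 := fun n => by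
    refine le_antisymm (ge_of_tendsto' hlim fun m => ?_) bot_le
    exact (measure_mono (sdiff_subset_sdiff_right (subset_iUnion _ m))).trans (hCμ n m).le
  refine ⟨K, hKn, hKc, hKcl, hK2, ⋂ n, ((↑) : G → G ⧸ K) '' O n,
    IsGδ.iInter_of_isOpen fun n => QuotientGroup.isOpenMap_coe _ (hOo n),
    subset_iInter fun n => image_mono (hNO n), ?_⟩
  refine le_antisymm (ge_of_tendsto' hlim fun n => ?_) bot_le
  have h0 := measure_saturation_sdiff_eq_zero μ K (hOo n) (hdiff n) (fun m => by
    have := hKV (Nat.pair n m)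
    simp only [Nat.unpair_pair] at this
    exact (mul_subset_mul_right this).trans (hVC n m))
  calc μ (((↑) : G → G ⧸ K) ⁻¹' ⋂ n, ((↑) : G → G ⧸ K) '' O n)
      ≤ μ (O n ∪ (((↑) : G → G ⧸ K) ⁻¹' (((↑) : G → G ⧸ K) '' O n) \ O n)) := by
        refine measure_mono fun x hx => ?_
        have := mem_iInter.1 hx n
        by_cases h : x ∈ O n
        · exact Or.inl h
        · exact Or.inr ⟨this, h⟩
    _ ≤ μ (O n) + 0 := by rw [← h0]; exact measure_union_le _ _
    _ ≤ _ := by rw [add_zero]; exact (hOμ n).le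

/-! ### Martin's axiom and null sets -/

open Cardinal in
theorem mk_isClosed_le_continuum (X : Type*) [TopologicalSpace X] [SecondCountableTopology X] :
    Cardinal.mk {s : Set X // IsClosed s} ≤ Cardinal.continuum := by
  let B := TopologicalSpace.countableBasis X
  have hB := TopologicalSpace.isBasis_countableBasis X
  have hinj : Function.Injective
      (fun s : {s : Set X // IsClosed s} => ({b : B | (b : Set X) ⊆ (s : Set X)ᶜ} : Set B)) := by
    intro s t hst
    have key : ∀ s : {s : Set X // IsClosed s},
        (s : Set X)ᶜ = ⋃ b ∈ {b : B | (b : Set X) ⊆ (s : Set X)ᶜ}, (b : Set X) := by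
      intro s
      refine Subset.antisymm (fun x hx => ?_) (iUnion₂_subset fun b hb => hb)
      obtain ⟨b, hb, hxb, hbs⟩ := hB.exists_subset_of_mem_open hx s.2.isOpen_compl
      exact mem_iUnion₂.2 ⟨⟨b, hb⟩, hbs, hxb⟩
    refine Subtype.ext (compl_injective ?_)
    rw [key s, key t]
    simp only at hst
    rw [hst]
  refine (mk_le_of_injective hinj).trans ?_
  rw [mk_set, ← two_power_aleph0]
  have : Countable B := (TopologicalSpace.countable_countableBasis X).to_subtype
  exact power_le_power_left two_ne_zero mk_le_aleph0

/-- The random forcing below a set `C`: compact subsets of `C` of positive measure. -/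
def PosCompact {X : Type*} [TopologicalSpace X] [MeasurableSpace X] (μ : Measure X)
    (C : Set X) : Type _ :=
  {L : Set X // IsCompact L ∧ L ⊆ C ∧ 0 < μ L}

open Cardinal in
theorem mk_posCompact_le_continuum {X : Type*} [TopologicalSpace X] [T2Space X]
    [SecondCountableTopology X] [MeasurableSpace X] (μ : Measure X) (C : Set X) :
    Cardinal.mk (PosCompact μ C) ≤ Cardinal.continuum := by
  refine le_trans (mk_le_of_injective (f := fun L : PosCompact μ C =>
    (⟨L.1, L.2.1.isClosed⟩ : {s : Set X // IsClosed s})) ?_) (mk_isClosed_le_continuum X)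
  intro L M h
  exact Subtype.ext (Subtype.mk.inj h)

/-- Martin's axiom in an arbitrary universe, for orders of size at most continuum. -/
theorem MartinsAxiom.exists_filter.{u, v} (hMA : MartinsAxiom) {P : Type u} [PartialOrder P] [Nonempty P]
    (hP : Cardinal.mk P ≤ Cardinal.continuum) (hccc : CountableChainCondition P)
    {ι : Type v} (hι : Cardinal.mk ι < Cardinal.continuum) (D : ι → Set P)
    (hD : ∀ i, ForcingDense (D i)) :
    ∃ F : Set P, F.Nonempty ∧ DirectedOn (· ≥ ·) F ∧ ∀ i, (F ∩ D i).Nonempty := by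
  have hsmall : Small.{0} P := by
    rw [← Cardinal.lift_continuum.{_, 0}, ← Cardinal.mk_set_nat, ← Cardinal.lift_id'.{0} (Cardinal.mk P)] at hP
    obtain ⟨g⟩ := Cardinal.lift_mk_le'.1 hP
    exact small_of_injective g.injective
  let e : P ≃ Shrink.{0} P := equivShrink P
  let : PartialOrder (Shrink.{0} P) := PartialOrder.lift e.symm e.symm.injective
  have : Nonempty (Shrink.{0} P) := e.nonempty_congr.1 inferInstance
  have hle : ∀ p q : P, e p ≤ e q ↔ p ≤ q := fun p q => by
    change e.symm (e p) ≤ e.symm (e q) ↔ _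
    simp
  have hccc' : CountableChainCondition (Shrink.{0} P) := by
    intro A hA
    have : (e ⁻¹' A).Countable := by
      refine hccc _ fun p hp q hq hpq => ?_
      rintro ⟨r, hrp, hrq⟩
      exact hA hp hq (e.injective.ne hpq) ⟨e r, (hle _ _).2 hrp, (hle _ _).2 hrq⟩
    have h2 := this.image e
    rwa [image_preimage_eq _ e.surjective] at h2
  have hcard : Cardinal.mk (range fun i => e '' D i) < Cardinal.continuum := by
    have h1 := Cardinal.mk_range_le_lift (f := fun i => e '' D i)
    have h2 := h1.trans_lt (Cardinal.lift_lt.2 hι)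
    rw [Cardinal.lift_continuum.{0, v}, ← Cardinal.lift_continuum.{v, 0}] at h2
    exact Cardinal.lift_lt.1 h2
  obtain ⟨F, hF⟩ := hMA (Shrink.{0} P) hccc' (range fun i => e '' D i) hcard (by
    rintro _ ⟨i, rfl⟩ p
    obtain ⟨d, hd, hdp⟩ := hD i (e.symm p)
    refine ⟨e d, mem_image_of_mem e hd, ?_⟩
    have := (hle _ _).2 hdp
    rwa [e.apply_symm_apply] at this)
  refine ⟨e ⁻¹' F, ?_, ?_, fun i => ?_⟩
  · obtain ⟨p, hp⟩ := F.nonempty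
    exact ⟨e.symm p, by simpa using hp⟩
  · intro p hp q hq
    obtain ⟨r, hr, hrp, hrq⟩ := F.directed _ hp _ hq
    refine ⟨e.symm r, by simpa using hr, (hle _ _).1 ?_, (hle _ _).1 ?_⟩
    · simpa using hrp
    · simpa using hrq
  · obtain ⟨_, hpF, p, hp, rfl⟩ := hF _ ⟨i, rfl⟩
    exact ⟨p, hpF, hp⟩

/-- Under Martin's axiom, fewer than continuum many null sets do not cover a compact set of
positive measure. -/
theorem MartinsAxiom.exists_mem_compact_notMem (hMA : MartinsAxiom) {X : Type*}
    [TopologicalSpace X] [T2Space X] [SecondCountableTopology X] [MeasurableSpace X]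
    [BorelSpace X] (μ : Measure X) [SigmaFinite μ] [μ.InnerRegular] {C : Set X} (hC : IsCompact C)
    (hCpos : 0 < μ C) {ι : Type*} (hι : Cardinal.mk ι < Cardinal.continuum) (N : ι → Set X)
    (hN : ∀ i, μ (N i) = 0) : ∃ x ∈ C, ∀ i, x ∉ N i := by
  let : PartialOrder (PosCompact μ C) := PartialOrder.lift Subtype.val Subtype.val_injective
  have : Nonempty (PosCompact μ C) := ⟨⟨C, hC, Subset.rfl, hCpos⟩⟩
  have hccc : CountableChainCondition (PosCompact μ C) := by
    intro A hA
    have h := Measure.countable_meas_pos_of_disjoint_iUnion₀ (μ := μ) (As := fun L : A => L.1.1)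
      (fun L => L.1.2.1.measurableSet.nullMeasurableSet) (fun L M hLM => by
        by_contra hpos
        refine hA L.2 M.2 (fun h => hLM (Subtype.ext h))
          ⟨⟨L.1.1 ∩ M.1.1, L.1.2.1.inter M.1.2.1, inter_subset_left.trans L.1.2.2.1,
            pos_iff_ne_zero.2 hpos⟩, ?_, ?_⟩
        · exact (inter_subset_left : L.1.1 ∩ M.1.1 ⊆ L.1.1)
        · exact (inter_subset_right : L.1.1 ∩ M.1.1 ⊆ M.1.1))
    have huniv : {L : A | 0 < μ L.1.1} = univ := eq_univ_of_forall fun L => L.1.2.2.2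
    rw [huniv, countable_univ_iff] at h
    exact h
  obtain ⟨F, hFne, hFdir, hF⟩ := hMA.exists_filter (mk_posCompact_le_continuum μ C) hccc hι
    (fun i => {L : PosCompact μ C | Disjoint L.1 (N i)}) (by
      intro i L
      obtain ⟨T, hNT, hT, hT0⟩ := exists_measurable_superset_of_null (hN i)
      have hpos : 0 < μ (L.1 \ T) := by
        rw [measure_sdiff_null hT0]; exact L.2.2.2
      obtain ⟨M, hML, hM, hMpos⟩ := (L.2.1.measurableSet.diff hT).exists_lt_isCompact hpos
      refine ⟨⟨M, hM, fun x hx => L.2.2.1 (hML hx).1, hMpos⟩, ?_, fun x hx => (hML hx).1⟩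
      exact disjoint_left.2 fun x hx hxN => (hML hx).2 (hNT hxN))
  -- The generic point: a directed family of nonempty compact sets has a common point.
  have hne : (⋂ L : F, L.1.1).Nonempty := by
    have : Nonempty F := hFne.to_subtype
    refine IsCompact.nonempty_iInter_of_directed_nonempty_isCompact_isClosed (fun L : F => L.1.1)
      ?_ (fun L => nonempty_of_measure_ne_zero L.1.2.2.2.ne') (fun L => L.1.2.1)
      (fun L => L.1.2.1.isClosed)
    intro L M
    obtain ⟨R, hR, hRL, hRM⟩ := hFdir _ L.2 _ M.2
    exact ⟨⟨R, hR⟩, hRL, hRM⟩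
  obtain ⟨x, hx⟩ := hne
  obtain ⟨L₀, hL₀⟩ := hFne
  refine ⟨x, L₀.2.2.1 (mem_iInter.1 hx ⟨L₀, hL₀⟩), fun i hxi => ?_⟩
  obtain ⟨L, hLF, hLi⟩ := hF i
  exact disjoint_left.1 hLi (mem_iInter.1 hx ⟨L, hLF⟩) hxi

/-- Under Martin's axiom, a nonempty null set in a second countable locally compact group has a
union of left translates that is a Bernstein-type set for the compact sets of positive measure. -/
theorem MartinsAxiom.exists_bernstein_mul (hMA : MartinsAxiom) {Q : Type*} [Group Q]
    [TopologicalSpace Q] [IsTopologicalGroup Q] [T2Space Q] [LocallyCompactSpace Q]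
    [SecondCountableTopology Q] [MeasurableSpace Q] [BorelSpace Q] (ν : Measure Q)
    [ν.IsHaarMeasure] {N : Set Q} (hN : ν N = 0) (hne : N.Nonempty) :
    ∃ A : Set Q, ∀ C : Set Q, IsCompact C → 0 < ν C →
      (C ∩ (A * N)).Nonempty ∧ (C \ (A * N)).Nonempty := by
  obtain ⟨n₀, hn₀⟩ := hne
  -- A well-order of minimal type, so that every stage has fewer than continuum many predecessors.
  obtain ⟨r, wo, hr⟩ := Cardinal.exists_ord_eq (PosCompact ν (univ : Set Q))
  have hinit : ∀ c, Cardinal.mk {d // r d c} < Cardinal.continuum := fun c =>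
    (Ordinal.card_typein (r := r) c).symm ▸
      (Cardinal.card_typein_lt c hr).trans_le (mk_posCompact_le_continuum ν univ)
  have hrec : ∀ c (g : {d // r d c} → Q × Q), ∃ p : Q × Q, p.2 ∈ c.1 ∧ p.1 * n₀ ∈ c.1 ∧
      (∀ d, (g d).2 ∉ p.1 • N) ∧ (∀ d, p.2 ∉ (g d).1 • N) ∧ p.2 ∉ p.1 • N := by
    intro c g
    obtain ⟨x, hxc, hx⟩ := hMA.exists_mem_compact_notMem ν c.2.1 c.2.2.2 (hinit c)
      (fun d => (g d).1 • N) (fun d => by rw [measure_smul, hN])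
    have hopt : Cardinal.mk (Option {d // r d c}) < Cardinal.continuum := by
      rw [Cardinal.mk_option]
      exact Cardinal.add_lt_of_lt Cardinal.aleph0_le_continuum (hinit c)
        (Cardinal.one_lt_aleph0.trans Cardinal.aleph0_lt_continuum)
    -- The new translator will be `k * n₀⁻¹`. The `k` for which its translate of `N` catches a given
    -- point `y` satisfy `n₀ * k⁻¹ * y ∈ N`, a null condition; the index `none` stands for the new
    -- point `x`.
    obtain ⟨k, hkc, hk⟩ := hMA.exists_mem_compact_notMem ν c.2.1 c.2.2.2 hopt
      (fun i => ((n₀ * ·) ⁻¹' ((· * i.elim x fun d => (g d).2) ⁻¹' N))⁻¹) (fun i => by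
        rw [measure_inv_null, measure_preimage_mul, measure_mul_right_null, hN])
    have key : ∀ y, n₀ * k⁻¹ * y ∉ N → y ∉ (k * n₀⁻¹) • N := by
      rintro y hy ⟨z, hz, rfl⟩
      apply hy
      simpa [mul_assoc] using hz
    refine ⟨(k * n₀⁻¹, x), hxc, by simpa using hkc, fun d => key _ ?_, hx, key _ ?_⟩
    · simpa using hk (some d)
    · simpa using hk none
  choose step hstep using hrec
  let F : PosCompact ν (univ : Set Q) → Q × Q :=
    wo.wf.fix fun c ih => step c fun d => ih d.1 d.2
  have hF : ∀ c, F c = step c fun d => F d.1 := fun c => wo.wf.fix_eq _ c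
  have hspec : ∀ c, (F c).2 ∈ c.1 ∧ (F c).1 * n₀ ∈ c.1 ∧
      (∀ d, r d c → (F d).2 ∉ (F c).1 • N) ∧ (∀ d, r d c → (F c).2 ∉ (F d).1 • N) ∧
      (F c).2 ∉ (F c).1 • N := by
    intro c
    have h := hstep c fun d => F d.1
    rw [← hF c] at h
    exact ⟨h.1, h.2.1, fun d hd => h.2.2.1 ⟨d, hd⟩, fun d hd => h.2.2.2.1 ⟨d, hd⟩, h.2.2.2.2⟩
  refine ⟨range fun c => (F c).1, fun C hC hCpos => ?_⟩
  let c : PosCompact ν (univ : Set Q) := ⟨C, hC, subset_univ C, hCpos⟩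
  refine ⟨⟨(F c).1 * n₀, (hspec c).2.1, mul_mem_mul ⟨c, rfl⟩ hn₀⟩, ⟨(F c).2, (hspec c).1, ?_⟩⟩
  rintro ⟨_, ⟨d, rfl⟩, n, hn, hdn⟩
  have hmem : (F c).2 ∈ (F d).1 • N := ⟨n, hn, hdn⟩
  rcases trichotomous_of r c d with h | h | h
  · exact (hspec d).2.2.1 c h hmem
  · rw [← h] at hmem
    exact (hspec c).2.2.2.2 hmem
  · exact (hspec c).2.2.2.1 d h hmem

/-! ### Nonmeasurable unions of translates -/

/-- Remove from `T` a measurable hull of `T \ S`; the Carathéodory identity and finiteness leave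
positive measure. -/
theorem IsHaarMeasurableSet.exists_measurableSet_pos {G : Type*} [MeasurableSpace G]
    {μ : Measure G} {S T : Set G} (hS : IsHaarMeasurableSet μ S) (hT : MeasurableSet T)
    (hTfin : μ T ≠ ∞) (hpos : μ (T ∩ S) ≠ 0) : ∃ E ⊆ S, MeasurableSet E ∧ 0 < μ E := by
  refine ⟨T \ toMeasurable μ (T \ S), fun x hx => ?_,
    hT.diff (measurableSet_toMeasurable _ _), ?_⟩
  · by_contra hxS
    exact hx.2 (subset_toMeasurable _ _ ⟨hx.1, hxS⟩)
  · have hfin : μ (T \ S) ≠ ∞ := ne_top_of_le_ne_top hTfin (measure_mono sdiff_subset)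
    have h : μ T = μ (T ∩ S) + μ (T \ S) := hS T
    refine lt_of_lt_of_le ?_ (le_measure_sdiff)
    rw [measure_toMeasurable, tsub_pos_iff_lt, h]
    rw [add_comm]
    exact ENNReal.lt_add_right hfin hpos

/-- A set that meets every compact set of positive measure, and whose complement does too,
is not Haar measurable. -/
theorem not_isHaarMeasurableSet_of_bernstein {G : Type*} [TopologicalSpace G] [MeasurableSpace G]
    {μ : Measure G} [SigmaFinite μ] [μ.InnerRegular] (hμ : μ ≠ 0) {S : Set G}
    (hS : ∀ C : Set G, IsCompact C → 0 < μ C → (C ∩ S).Nonempty ∧ (C \ S).Nonempty) :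
    ¬ IsHaarMeasurableSet μ S := by
  intro hm
  obtain ⟨n, hn⟩ : ∃ n, μ (spanningSets μ n) ≠ 0 := by
    by_contra! h
    apply hμ
    rw [← Measure.measure_univ_eq_zero, ← iUnion_spanningSets μ]
    exact measure_iUnion_null h
  have hms := measurableSet_spanningSets μ n
  have hfin := (measure_spanningSets_lt_top μ n).ne
  have h : μ (spanningSets μ n) = μ (spanningSets μ n ∩ S) + μ (spanningSets μ n \ S) := hm _
  by_cases h0 : μ (spanningSets μ n ∩ S) = 0
  · have hm' : IsHaarMeasurableSet μ Sᶜ := OuterMeasure.isCaratheodory_compl _ hm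
    obtain ⟨E, hES, hE, hEpos⟩ := hm'.exists_measurableSet_pos hms hfin (by
      rw [h, h0, zero_add] at hn; exact hn)
    obtain ⟨C, hCE, hC, hCpos⟩ := hE.exists_lt_isCompact hEpos
    obtain ⟨x, hxC, hxS⟩ := (hS C hC hCpos).1
    exact hES (hCE hxC) hxS
  · obtain ⟨E, hES, hE, hEpos⟩ := hm.exists_measurableSet_pos hms hfin h0
    obtain ⟨C, hCE, hC, hCpos⟩ := hE.exists_lt_isCompact hEpos
    obtain ⟨x, hxC, hxS⟩ := (hS C hC hCpos).2
    exact hxS (hES (hCE hxC))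

/-- Properness makes the pushforward of `μ` a Haar measure on `Q`. The Bernstein property lifts
along `π`, since compact sets of positive measure have images of the same kind. -/
theorem MartinsAxiom.exists_mul_not_isHaarMeasurableSet_of_proper (hMA : MartinsAxiom)
    {G Q : Type*} [Group G] [TopologicalSpace G] [IsTopologicalGroup G] [LocallyCompactSpace G]
    [SigmaCompactSpace G] [MeasurableSpace G] [BorelSpace G] (μ : Measure G) [μ.IsHaarMeasure]
    [μ.Regular] [Group Q] [TopologicalSpace Q] [IsTopologicalGroup Q] [T2Space Q]
    [LocallyCompactSpace Q] [SecondCountableTopology Q] {π : G →* Q} (hπ : Continuous π)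
    (hsurj : Function.Surjective π) (hprop : Tendsto π (cocompact G) (cocompact Q))
    {N : Set G} (hne : N.Nonempty) {T : Set Q} (hT : IsGδ T) (hNT : π '' N ⊆ T)
    (hT0 : μ (π ⁻¹' T) = 0) : ∃ B : Set G, ¬ IsHaarMeasurableSet μ (B * N) := by
  borelize Q
  have := Measure.isHaarMeasure_map μ π hπ hsurj hprop
  have hν : μ.map π (π '' N) = 0 := by
    refine measure_mono_null hNT ?_
    rwa [Measure.map_apply hπ.measurable hT.measurableSet]
  obtain ⟨A, hA⟩ := hMA.exists_bernstein_mul (μ.map π) hν (hne.image π)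
  have hpre : π ⁻¹' A * N = π ⁻¹' (A * π '' N) := by
    ext y
    constructor
    · rintro ⟨a, ha, n, hn, rfl⟩
      exact ⟨π a, ha, π n, mem_image_of_mem π hn, (map_mul π a n).symm⟩
    · rintro ⟨a, ha, _, ⟨n, hn, rfl⟩, h⟩
      refine ⟨y * n⁻¹, ?_, n, hn, by simp⟩
      have h' : a * π n = π y := h
      simpa [← h'] using ha
  refine ⟨π ⁻¹' A, ?_⟩
  rw [hpre]
  refine not_isHaarMeasurableSet_of_bernstein (NeZero.ne μ) fun C hC hCpos => ?_
  obtain ⟨⟨_, ⟨x, hx, rfl⟩, h1⟩, ⟨_, ⟨y, hy, rfl⟩, h2⟩⟩ := hA (π '' C) (hC.image hπ) (by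
    rw [Measure.map_apply hπ.measurable (hC.image hπ).measurableSet]
    exact hCpos.trans_le (measure_mono (subset_preimage_image π C)))
  exact ⟨⟨x, hx, h1⟩, ⟨y, hy, h2⟩⟩

/-- Under Martin's axiom, every nonempty null set of a σ-compact locally compact group has a
nonmeasurable union of left translates. -/
theorem MartinsAxiom.exists_mul_not_isHaarMeasurableSet (hMA : MartinsAxiom) {G : Type*} [Group G]
    [TopologicalSpace G] [IsTopologicalGroup G] [LocallyCompactSpace G] [SigmaCompactSpace G]
    [MeasurableSpace G] [BorelSpace G] (μ : Measure G) [μ.IsHaarMeasure] [μ.Regular] {N : Set G}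
    (hN : μ N = 0) (hne : N.Nonempty) : ∃ B : Set G, ¬ IsHaarMeasurableSet μ (B * N) := by
  obtain ⟨K, hKn, hKc, hKcl, hK2, T, hT, hNT, hT0⟩ := exists_null_saturation μ hN
  have hfib : ∀ q : G ⧸ K, IsCompact ((QuotientGroup.mk' K) ⁻¹' {q}) := by
    intro q
    obtain ⟨x, rfl⟩ := QuotientGroup.mk_surjective q
    have h : (QuotientGroup.mk' K) ⁻¹' {(x : G ⧸ K)} = x • (K : Set G) := by
      ext y
      simp [mem_smul_set_iff_inv_smul_mem, ← QuotientGroup.eq, eq_comm]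
    rw [h]
    exact hKc.smul x
  have hproper : IsProperMap (QuotientGroup.mk' K) :=
    isProperMap_iff_isClosedMap_and_compact_fibers.2
      ⟨QuotientGroup.continuous_mk, QuotientGroup.isClosedMap_coe hKc, @hfib⟩
  have hprop : Tendsto (QuotientGroup.mk' K) (cocompact G) (cocompact (G ⧸ K)) :=
    (isProperMap_iff_tendsto_cocompact.1 hproper).2
  exact hMA.exists_mul_not_isHaarMeasurableSet_of_proper μ (π := QuotientGroup.mk' K)
    QuotientGroup.continuous_mk (QuotientGroup.mk'_surjective K) hprop hne hT hNT hT0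

/-! ### Continuity of measurable homomorphisms -/

theorem MartinsAxiom.continuous_of_isHaarMeasurableMap_of_sigmaCompact (hMA : MartinsAxiom)
    {G H : Type*} [Group G] [TopologicalSpace G] [IsTopologicalGroup G] [LocallyCompactSpace G]
    [SigmaCompactSpace G] [MeasurableSpace G] [BorelSpace G] (μ : Measure G) [μ.IsHaarMeasure]
    [μ.Regular] [Group H] [TopologicalSpace H] [IsTopologicalGroup H] (f : G →* H)
    (hf : IsHaarMeasurableMap μ f) : Continuous f := by
  refine continuous_of_continuousAt_one f fun U hU => ?_
  rw [map_one] at hU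
  obtain ⟨V₀, hV₀, hVU⟩ := exists_nhds_split_inv hU
  obtain ⟨V, hVV₀, hV, h1V⟩ := mem_nhds_iff.1 hV₀
  by_cases hN : μ (f ⁻¹' V) = 0
  · obtain ⟨B, hB⟩ := hMA.exists_mul_not_isHaarMeasurableSet μ hN ⟨1, by simpa using h1V⟩
    refine absurd ?_ hB
    have h : B * f ⁻¹' V = f ⁻¹' (f '' B * V) := by
      ext y
      constructor
      · rintro ⟨b, hb, n, hn, rfl⟩
        exact ⟨f b, mem_image_of_mem f hb, f n, hn, (map_mul f b n).symm⟩
      · rintro ⟨_, ⟨b, hb, rfl⟩, v, hv, h⟩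
        refine ⟨b, hb, b⁻¹ * y, ?_, by simp⟩
        have h' : f b * v = f y := h
        simpa [← h'] using hv
    rw [h]
    exact hf _ hV.mul_left
  · obtain ⟨n, hn⟩ : ∃ n, μ (spanningSets μ n ∩ f ⁻¹' V) ≠ 0 := by
      by_contra! h
      apply hN
      rw [← univ_inter (f ⁻¹' V), ← iUnion_spanningSets μ, iUnion_inter]
      exact measure_iUnion_null h
    obtain ⟨E, hEV, hE, hEpos⟩ := IsHaarMeasurableSet.exists_measurableSet_pos (hf V hV)
      (measurableSet_spanningSets μ n) (measure_spanningSets_lt_top μ n).ne hn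
    refine mem_map.2 (mem_of_superset (Measure.div_mem_nhds_one_of_haar_pos μ E hE hEpos) ?_)
    rintro _ ⟨x, hx, y, hy, rfl⟩
    change f (x / y) ∈ U
    rw [map_div]
    exact hVU _ (hVV₀ (hEV hx)) _ (hVV₀ (hEV hy))

/-- The powers of a symmetric compact neighborhood of `1` exhaust the subgroup it generates. -/
theorem exists_isOpen_sigmaCompact_subgroup (G : Type*) [Group G] [TopologicalSpace G]
    [IsTopologicalGroup G] [LocallyCompactSpace G] :
    ∃ L : Subgroup G, IsOpen (L : Set G) ∧ IsSigmaCompact (L : Set G) := by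
  obtain ⟨C, hC, hC1⟩ := exists_compact_mem_nhds (1 : G)
  let D : Set G := C ∪ C⁻¹
  have hD : IsCompact D := hC.union hC.inv
  have hDinv : D⁻¹ = D := by simp [D, union_comm]
  let L : Subgroup G :=
    { carrier := ⋃ n : ℕ, D ^ n
      one_mem' := mem_iUnion.2 ⟨0, by simp⟩
      mul_mem' := fun {x y} hx hy => by
        obtain ⟨n, hn⟩ := mem_iUnion.1 hx
        obtain ⟨m, hm⟩ := mem_iUnion.1 hy
        exact mem_iUnion.2 ⟨n + m, by rw [pow_add]; exact mul_mem_mul hn hm⟩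
      inv_mem' := fun {x} hx => by
        obtain ⟨n, hn⟩ := mem_iUnion.1 hx
        exact mem_iUnion.2 ⟨n, by rw [← hDinv, inv_pow]; exact Set.inv_mem_inv.2 hn⟩ }
  refine ⟨L, L.isOpen_of_mem_nhds (g := 1) (mem_of_superset hC1 fun x hx => ?_), ?_⟩
  · exact mem_iUnion.2 ⟨1, by rw [pow_one]; exact Or.inl hx⟩
  · refine isSigmaCompact_iUnion_of_isCompact (fun n : ℕ => D ^ n) fun n => ?_
    induction n with
    | zero => simp
    | succ n ih => rw [pow_succ]; exact ih.mul hD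

theorem IsHaarMeasurableMap.comp_of_measurableEmbedding {G L Y : Type*} [MeasurableSpace G]
    [MeasurableSpace L] [TopologicalSpace Y] {μ : Measure G} {f : G → Y}
    (hf : IsHaarMeasurableMap μ f) {i : L → G} (hi : MeasurableEmbedding i) :
    IsHaarMeasurableMap (μ.comap i) (f ∘ i) := by
  intro U hU T
  have h : μ (i '' T) = μ (i '' T ∩ f ⁻¹' U) + μ (i '' T \ f ⁻¹' U) := hf U hU (i '' T)
  change μ.comap i T = μ.comap i (T ∩ f ∘ i ⁻¹' U) + μ.comap i (T \ f ∘ i ⁻¹' U)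
  rw [hi.comap_apply, hi.comap_apply, hi.comap_apply, h]
  congr 2
  · rw [preimage_comp, image_inter_preimage]
  · rw [preimage_comp, image_sdiff_preimage]

theorem theorem3 (hMA : MartinsAxiom)
    {G H : Type*} [Group G] [TopologicalSpace G] [IsTopologicalGroup G] [LocallyCompactSpace G]
    [MeasurableSpace G] [BorelSpace G]
    (μ : MeasureTheory.Measure G) [μ.IsHaarMeasure] [μ.Regular]
    [Group H] [TopologicalSpace H] [IsTopologicalGroup H]
    (f : G →* H) (hf : IsHaarMeasurableMap μ f) :
    Continuous f := by
  obtain ⟨L, hL, hLσ⟩ := exists_isOpen_sigmaCompact_subgroup G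
  have hemb : IsOpenEmbedding L.subtype := hL.isOpenEmbedding_subtypeVal
  have : LocallyCompactSpace L := hL.locallyCompactSpace
  have : SigmaCompactSpace L := isSigmaCompact_iff_sigmaCompactSpace.1 hLσ
  have : (μ.comap L.subtype).IsHaarMeasure := Measure.IsHaarMeasure.comap (mH := ContinuousMul.measurableMul) μ hemb
  have : (μ.comap L.subtype).Regular := Measure.Regular.comap' μ hemb
  have hcont : Continuous (f.comp L.subtype) :=
    hMA.continuous_of_isHaarMeasurableMap_of_sigmaCompact (μ.comap L.subtype) _
      (hf.comp_of_measurableEmbedding hemb.measurableEmbedding)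
  -- As `L` is open, continuity at `1` on `L` is continuity at `1` on `G`.
  refine continuous_of_continuousAt_one f ?_
  have h := hcont.continuousAt (x := 1)
  rw [MonoidHom.coe_comp, hemb.continuousAt_iff] at h
  simpa using h
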